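/- Let $(\mathcal M,\rho)$ be a pseudometric space, where $\rho:\mathcal M\times\mathcal M\to[0,+\infty]$ is symmetric, vanishes on the diagonal and satisfies the triangle inequality ($\rho(x,y)=0$ for $x\neq y$ and $\rho(x,y)=+\infty$ are allowed). Let $X$ be a real two-dimensional Banach space, let $\mathcal K(X)$ be the family of all non-empty compact convex subsets of $X$, let $\lambda>0$, and let $F:\mathcal M\to\mathcal K(X)$. A selection of $F$ on a set $S\subset\mathcal M$ is a map $f:S\to X$ with $f(x)\in F(x)$ for all $x\in S$; its Lipschitz seminorm is $$\|f\|_{\mathrm{Lip}(S,X)}=\inf\{\mu>0:\ \|f(x)-f(y)\|\le\mu\,\rho(x,y)\ \text{ for all } x,y\in S\}$$ (with $\inf\emptyset=+\infty$). Suppose that for every subset $\mathcal M'\subset\mathcal M$ consisting of at most four points, the restriction $F|_{\mathcal M'}$ has a Lipschitz selection $f_{\mathcal M'}:\mathcal M'\to X$ with $\|f_{\mathcal M'}\|_{\mathrm{Lip}(\mathcal M',X)}\le\lambda$. Then $F$ has a Lipschitz selection $f:\mathcal M\to X$ with $$\|f\|_{\mathrm{Lip}(\mathcal M,X)}\le 6\lambda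 .$$ Furthermore, if $X$ is (linearly isometric to) $\ell_\infty^2$, that is, $\mathbf R^2$ with the norm $\|x\|=\max\{|x_1|,|x_2|\}$, then $f$ can be chosen so that $\|f\|_{\mathrm{Lip}(\mathcal M,X)}\le 4\lambda$. -/

import Mathlib

open scoped NNReal ENNReal

/-- The Lipschitz seminorm `inf {K > 0 : ‖f x - f y‖ ≤ K ρ(x, y) for all x, y}` of a map from a
pseudometric space (distances in `[0, ∞]`, distinct points at distance zero allowed) to a normed
space. It takes values in `[0, ∞]` and is `∞` exactly when `f` is not Lipschitz. -/
noncomputable def lipSeminorm {M X : Type*} [PseudoEMetricSpace M] [NormedAddCommGroup X]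
    (f : M → X) : ℝ≥0∞ :=
  ⨅ (K : ℝ≥0) (_ : 0 < K) (_ : ∀ x y : M, ‖f x - f y‖ₑ ≤ K * edist x y), (K : ℝ≥0∞)

/-- `f` is a selection of the set-valued map `F`, whose values are non-empty compact convex
sets (`ConvexBody X`; no interior point is required). -/
def IsSelection {M X : Type*} [NormedAddCommGroup X] [NormedSpace ℝ X]
    (F : M → ConvexBody X) (f : M → X) : Prop :=
  ∀ x, f x ∈ F x

/-- `X` is the space `ℓ∞²`, up to a linear isometry: the type `Fin 2 → ℝ` carries the uniform
norm `max |x₁| |x₂|`. -/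
def IsEllInftyTwo (X : Type*) [NormedAddCommGroup X] [NormedSpace ℝ X] : Prop :=
  Nonempty (X ≃ₗᵢ[ℝ] (Fin 2 → ℝ))

/-! Rescale ρ so that λ = 1, and take linear coordinates in which the norm of X lies between the
maximum norm and c times it: c = 1 for ℓ∞², c = 2 in general, by an Auerbach basis. It then suffices
to find a selection of constant 3 in the plane with the maximum norm.

For each x let K_x be the set of points whose distance to F u is at most ρ(x, u) for every u; the
case u = x gives K_x ⊆ F x. The maximum norm is injective, so a selection on four points extends to
M, and Helly's theorem makes K_x non-empty. Helly with a half-plane as one of the three sets shows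
that a bound on a coordinate over K_x is already forced, up to any slack, by two of the intersected
sets. Two such pairs, hence four points, give min over K_x ≤ max over K_y + ρ(x, y) for each
coordinate (`HasFourPointSelections.exists_le_add`). McShane's formula then yields a 1-Lipschitz g
with g x in the bounding box of K_x.

The selection sends x to the point of K_x nearest to g x. Because g x is in the box, a separating
line is not parallel to an axis, so the nearest point is a corner of the square about g x. With δ =
ρ(x, y), K_y is only known to lie within δ of each set intersected in K_x, not of K_x itself; still,
the separating line moved by δ bounds K_y (`IsCornerProjection.sep_of_near`). Comparing both lines,
the displacements at x and y differ by at most 2δ, and g adds one more δ. -/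

/-! ### Nearest points in the maximum norm from inside the bounding box. -/

/-- `(p.1 + r s₁, p.2 + r s₂)` is a point of `K` nearest to `p` in the maximum norm, it is a vertex
of the square of radius `r` about `p`, and the functional with coefficients `n₁ s₁` and `n₂ s₂`
separates that square from `K`. -/
structure IsCornerProjection (K : Set (ℝ × ℝ)) (p : ℝ × ℝ) (r s₁ s₂ n₁ n₂ : ℝ) : Prop where
  nonneg : 0 ≤ r
  sign₁ : s₁ = 1 ∨ s₁ = -1
  sign₂ : s₂ = 1 ∨ s₂ = -1
  pos₁ : 0 < n₁
  pos₂ : 0 < n₂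
  mem : (p.1 + r * s₁, p.2 + r * s₂) ∈ K
  sep : 0 < r → ∀ k ∈ K, r * (n₁ + n₂) ≤ n₁ * (s₁ * (k.1 - p.1)) + n₂ * (s₂ * (k.2 - p.2))

/-- `p` lies in the smallest rectangle with sides parallel to the axes that contains `K`. -/
structure MemBox (K : Set (ℝ × ℝ)) (p : ℝ × ℝ) : Prop where
  left : ∃ k ∈ K, k.1 ≤ p.1
  right : ∃ k ∈ K, p.1 ≤ k.1
  below : ∃ k ∈ K, k.2 ≤ p.2
  above : ∃ k ∈ K, p.2 ≤ k.2

theorem MemBox.exists_sign_fst {K : Set (ℝ × ℝ)} {p : ℝ × ℝ} (h : MemBox K p) {s : ℝ}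
    (hs : s = 1 ∨ s = -1) : ∃ k ∈ K, s * (k.1 - p.1) ≤ 0 := by
  rcases hs with rfl | rfl
  · obtain ⟨k, hk, h⟩ := h.left
    exact ⟨k, hk, by linarith⟩
  · obtain ⟨k, hk, h⟩ := h.right
    exact ⟨k, hk, by linarith⟩

theorem MemBox.exists_sign_snd {K : Set (ℝ × ℝ)} {p : ℝ × ℝ} (h : MemBox K p) {s : ℝ}
    (hs : s = 1 ∨ s = -1) : ∃ k ∈ K, s * (k.2 - p.2) ≤ 0 := by
  rcases hs with rfl | rfl
  · obtain ⟨k, hk, h⟩ := h.below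
    exact ⟨k, hk, by linarith⟩
  · obtain ⟨k, hk, h⟩ := h.above
    exact ⟨k, hk, by linarith⟩

theorem MemBox.swap {K : Set (ℝ × ℝ)} {p : ℝ × ℝ} (h : MemBox K p) :
    MemBox (Prod.swap ⁻¹' K) p.swap where
  left := let ⟨k, hk, h⟩ := h.below; ⟨k.swap, hk, h⟩
  right := let ⟨k, hk, h⟩ := h.above; ⟨k.swap, hk, h⟩
  below := let ⟨k, hk, h⟩ := h.left; ⟨k.swap, hk, h⟩
  above := let ⟨k, hk, h⟩ := h.right; ⟨k.swap, hk, h⟩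

theorem IsCornerProjection.swap {K : Set (ℝ × ℝ)} {p : ℝ × ℝ} {r s₁ s₂ n₁ n₂ : ℝ}
    (h : IsCornerProjection K p r s₁ s₂ n₁ n₂) :
    IsCornerProjection (Prod.swap ⁻¹' K) p.swap r s₂ s₁ n₂ n₁ where
  nonneg := h.nonneg
  sign₁ := h.sign₂
  sign₂ := h.sign₁
  pos₁ := h.pos₂
  pos₂ := h.pos₁
  mem := h.mem
  sep hr k hk := by
    have := h.sep hr k.swap hk
    simp only [Prod.fst_swap, Prod.snd_swap] at this ⊢
    linarith

theorem exists_isCornerProjection {K : Set (ℝ × ℝ)} (hK : IsCompact K) (hconv : Convex ℝ K)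
    {p : ℝ × ℝ} (hp : MemBox K p) :
    ∃ r s₁ s₂ n₁ n₂, IsCornerProjection K p r s₁ s₂ n₁ n₂ := by
  have hne : K.Nonempty := let ⟨k, hk, _⟩ := hp.left; ⟨k, hk⟩
  obtain ⟨q, hqK, hq⟩ := hK.exists_infDist_eq_dist hne p
  by_cases hpK : p ∈ K
  -- At radius 0 nothing has to be separated, so signs and coefficients are arbitrary.
  · exact ⟨0, 1, 1, 1, 1, le_rfl, .inl rfl, .inl rfl, one_pos, one_pos, by simpa using hpK,
      fun h => absurd h (lt_irrefl _)⟩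
  set r := Metric.infDist p K with hr
  have hr0 : 0 < r := (hK.isClosed.notMem_iff_infDist_pos hne).1 hpK
  obtain ⟨f, u, hfb, hfK⟩ := geometric_hahn_banach_open (convex_ball p r) Metric.isOpen_ball hconv
    (Metric.disjoint_ball_infDist (x := p) (s := K))
  have hf (v : ℝ × ℝ) : f v = f (1, 0) * v.1 + f (0, 1) * v.2 := by
    have : v = v.1 • ((1, 0) : ℝ × ℝ) + v.2 • ((0, 1) : ℝ × ℝ) := by ext <;> simp
    conv_lhs => rw [this]
    rw [map_add, map_smul, map_smul, smul_eq_mul, smul_eq_mul]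
    ring
  set a := f (1, 0)
  set b := f (0, 1)
  have hsign (c : ℝ) : ∃ s : ℝ, (s = 1 ∨ s = -1) ∧ c * s = |c| := by
    rcases le_total 0 c with h | h
    · exact ⟨1, .inl rfl, by rw [abs_of_nonneg h, mul_one]⟩
    · exact ⟨-1, .inr rfl, by rw [abs_of_nonpos h]; ring⟩
  obtain ⟨s₁, hs₁, has⟩ := hsign a
  obtain ⟨s₂, hs₂, hbs⟩ := hsign b
  have ha1 : |s₁| = 1 := by rcases hs₁ with rfl | rfl <;> simp
  have hb1 : |s₂| = 1 := by rcases hs₂ with rfl | rfl <;> simp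
  have hs₁' : s₁ * s₁ = 1 := by rcases hs₁ with rfl | rfl <;> norm_num
  have hs₂' : s₂ * s₂ = 1 := by rcases hs₂ with rfl | rfl <;> norm_num
  -- Over the closed square, `f` is largest at the corner picked by the signs of its coefficients.
  have key : f p + r * (|a| + |b|) ≤ u := by
    have hcl : (p.1 + r * s₁, p.2 + r * s₂) ∈ closure (Metric.ball p r) := by
      rw [closure_ball p hr0.ne', Metric.mem_closedBall, Prod.dist_eq, Real.dist_eq, Real.dist_eq]
      simp [abs_mul, ha1, hb1, abs_of_pos hr0]
    have := closure_minimal (fun x hx => (hfb x hx).le : Metric.ball p r ⊆ {x | f x ≤ u})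
      (isClosed_le f.continuous continuous_const) hcl
    change f _ ≤ u at this
    rw [hf] at this ⊢
    simp only at this
    rw [← has, ← hbs]
    linarith
  have hsep (k) (hk : k ∈ K) : r * (|a| + |b|) ≤ a * (k.1 - p.1) + b * (k.2 - p.2) := by
    have := hfK k hk
    rw [hf] at this key
    linarith
  have hpos : ¬ (a = 0 ∧ b = 0) := by
    rintro ⟨h1, h2⟩
    have h3 := hfb p (Metric.mem_ball_self hr0)
    have h4 := hfK q hqK
    rw [hf, h1, h2] at h3 h4
    linarith
  -- A vanishing coefficient would put all of `K` strictly to one side of `p` in the other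
  -- coordinate, against `hp`.
  have ha : a ≠ 0 := by
    intro h0
    have hb : 0 < |b| := abs_pos.2 fun h => hpos ⟨h0, h⟩
    obtain ⟨k, hk, hk'⟩ := hp.exists_sign_snd hs₂
    have h1 := hsep k hk
    rw [h0, abs_zero, zero_mul, zero_add, zero_add] at h1
    have h2 : b * (k.2 - p.2) = |b| * (s₂ * (k.2 - p.2)) := by
      rw [← hbs]; linear_combination (-b * (k.2 - p.2)) * hs₂'
    have h3 := mul_pos hr0 hb
    nlinarith
  have hb : b ≠ 0 := by
    intro h0
    have hb : 0 < |a| := abs_pos.2 ha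
    obtain ⟨k, hk, hk'⟩ := hp.exists_sign_fst hs₁
    have h1 := hsep k hk
    rw [h0, abs_zero, zero_mul, add_zero, add_zero] at h1
    have h2 : a * (k.1 - p.1) = |a| * (s₁ * (k.1 - p.1)) := by
      rw [← has]; linear_combination (-a * (k.1 - p.1)) * hs₁'
    have h3 := mul_pos hr0 hb
    nlinarith
  have ha' := abs_pos.2 ha
  have hb' := abs_pos.2 hb
  have hsep' (k) (hk : k ∈ K) :
      r * (|a| + |b|) ≤ |a| * (s₁ * (k.1 - p.1)) + |b| * (s₂ * (k.2 - p.2)) := by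
    have := hsep k hk
    have e1 : |a| * (s₁ * (k.1 - p.1)) = a * (k.1 - p.1) := by
      rw [← has]; linear_combination (a * (k.1 - p.1)) * hs₁'
    have e2 : |b| * (s₂ * (k.2 - p.2)) = b * (k.2 - p.2) := by
      rw [← hbs]; linear_combination (b * (k.2 - p.2)) * hs₂'
    rwa [e1, e2]
  refine ⟨r, s₁, s₂, |a|, |b|, hr0.le, hs₁, hs₂, ha', hb', ?_, fun _ => hsep'⟩
  have hqd : max |p.1 - q.1| |p.2 - q.2| = r := by
    rw [hq, Prod.dist_eq, Real.dist_eq, Real.dist_eq]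
  have h1 : |p.1 - q.1| ≤ r := hqd ▸ le_max_left _ _
  have h2 : |p.2 - q.2| ≤ r := hqd ▸ le_max_right _ _
  have h1' : s₁ * (q.1 - p.1) ≤ r := by
    refine (le_abs_self _).trans ?_
    rwa [abs_mul, ha1, one_mul, abs_sub_comm]
  have h2' : s₂ * (q.2 - p.2) ≤ r := by
    refine (le_abs_self _).trans ?_
    rwa [abs_mul, hb1, one_mul, abs_sub_comm]
  -- Both coordinates of `q - p` are bounded by `r`, yet their weighted sum reaches the maximum; the
  -- weights are positive, so both bounds are equalities.
  have h3 := hsep' q hqK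
  have e1 : s₁ * (q.1 - p.1) = r := le_antisymm h1' <| by
    by_contra! h
    nlinarith [mul_lt_mul_of_pos_left h ha', mul_le_mul_of_nonneg_left h2' hb'.le]
  have e2 : s₂ * (q.2 - p.2) = r := le_antisymm h2' <| by
    by_contra! h
    nlinarith [mul_lt_mul_of_pos_left h hb', mul_le_mul_of_nonneg_left h1' ha'.le]
  have : (p.1 + r * s₁, p.2 + r * s₂) = q := by
    ext
    · simp only
      linear_combination (-s₁) * e1 + (q.1 - p.1) * hs₁'
    · simp only
      linear_combination (-s₂) * e2 + (q.2 - p.2) * hs₂'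
  rwa [this]

/-! ### Separating lines of an intersection and points near each of its members. -/

/-- If no point of the convex sets `C i` lies below the line `n₁ x + n₂ y = 0` at once, then
no `k` above points of all the `C i` lies below it. -/
theorem separation_of_dominated {ι : Type*} {C : ι → Set (ℝ × ℝ)} (hC : ∀ i, Convex ℝ (C i))
    {n₁ n₂ : ℝ} (hn₁ : 0 < n₁) (hn₂ : 0 < n₂)
    (hsep : ∀ v : ℝ × ℝ, (∀ i, v ∈ C i) → 0 ≤ n₁ * v.1 + n₂ * v.2)
    (h0 : ∀ i, (0 : ℝ × ℝ) ∈ C i) {z w : ℝ × ℝ} (hz : ∀ i, z ∈ C i) (hw : ∀ i, w ∈ C i)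
    (hz1 : z.1 < 0) (hw2 : w.2 < 0) {k : ℝ × ℝ} {R : ℝ}
    (hk : ∀ i, ∃ c ∈ C i, c.1 ≤ k.1 ∧ c.2 ≤ k.2 ∧ k.1 - R ≤ c.1 ∧ k.2 - R ≤ c.2) :
    0 ≤ n₁ * k.1 + n₂ * k.2 := by
  by_contra! hlt
  have hzn := hsep z hz
  have hwn := hsep w hw
  have hz2 : 0 < z.2 := by nlinarith [mul_pos hn₁ (neg_pos.2 hz1)]
  have hw1 : 0 < w.1 := by nlinarith [mul_pos hn₂ (neg_pos.2 hw2)]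
  -- As `A` and `B` do not depend on `i`, one `ε` makes `ε • k` a convex combination of `0`, `c`,
  -- `z`, `w` in every `C i`. It lies below the line, against `hsep`.
  suffices h : ∃ A B : ℝ, 0 ≤ A ∧ 0 ≤ B ∧ ∀ i, ∃ c ∈ C i, ∃ θ α β : ℝ, 0 ≤ θ ∧ θ ≤ 1 ∧ 0 ≤ α ∧
      α ≤ A ∧ 0 ≤ β ∧ β ≤ B ∧ k = θ • c + α • z + β • w by
    obtain ⟨A, B, hA, hB, h⟩ := h
    have hε : 0 < 1 / (1 + A + B) := by positivity
    set ε := 1 / (1 + A + B) with hεd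
    have hε1 : ε * (1 + A + B) = 1 := by rw [hεd]; field_simp
    have := hsep (ε • k) fun i => by
      obtain ⟨c, hc, θ, α, β, hθ, hθ1, hα, hαA, hβ, hβB, rfl⟩ := h i
      have h1 : θ + α + β ≤ 1 + A + B := by linarith
      have h2 : ε * (θ + α + β) ≤ 1 := hε1 ▸ mul_le_mul_of_nonneg_left h1 hε.le
      rcases (by positivity : 0 ≤ θ + α + β).eq_or_lt with h3 | h3
      · have e1 : θ = 0 := by linarith
        have e2 : α = 0 := by linarith
        have e3 : β = 0 := by linarith
        simpa [e1, e2, e3] using h0 i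
      · have h4 : (θ / (θ + α + β)) • c + (α / (θ + α + β)) • z + (β / (θ + α + β)) • w ∈ C i := by
          have := (hC i).sum_mem (t := Finset.univ)
            (w := ![θ / (θ + α + β), α / (θ + α + β), β / (θ + α + β)]) (z := ![c, z, w])
            (by
              intro j _
              fin_cases j <;> simp <;> positivity)
            (by simp [Fin.sum_univ_three]; field_simp)
            (by
              intro j _
              fin_cases j
              · exact hc
              · exact hz i
              · exact hw i)
          simpa [Fin.sum_univ_three] using this
        have h5 := (hC i).smul_mem_of_zero_mem (h0 i) h4
          (t := ε * (θ + α + β)) ⟨by positivity, h2⟩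
        have e (t : ℝ) : ε * (θ + α + β) * (t / (θ + α + β)) = ε * t := by field_simp
        simpa only [smul_add, smul_smul, e] using h5
    simp only [Prod.smul_fst, Prod.smul_snd, smul_eq_mul] at this
    nlinarith
  rcases eq_or_ne (w.1 * z.2 - w.2 * z.1) 0 with hD | hD
  -- Here `z` and `w` point in opposite directions along the line itself: `θ` brings `c` to the
  -- level of `k`, and the rest is a multiple of `z` or of `w`.
  · have hzn0 : n₁ * z.1 + n₂ * z.2 = 0 := by
      refine le_antisymm ?_ hzn
      have e : w.1 * (n₁ * z.1 + n₂ * z.2) = z.1 * (n₁ * w.1 + n₂ * w.2) := by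
        linear_combination n₂ * hD
      by_contra! h
      nlinarith [mul_pos hw1 h]
    have hwn0 : n₁ * w.1 + n₂ * w.2 = 0 := by
      refine le_antisymm ?_ hwn
      have e : w.1 * (n₁ * z.1 + n₂ * z.2) = z.1 * (n₁ * w.1 + n₂ * w.2) := by
        linear_combination n₂ * hD
      by_contra! h
      nlinarith [mul_pos (neg_pos.2 hz1) h]
    refine ⟨(2 * |k.1| + |R|) / (-z.1), (2 * |k.1| + |R|) / w.1,
      div_nonneg (by positivity) (by linarith), by positivity, fun i => ?_⟩
    obtain ⟨c, hc, h1, h2, h3, h4⟩ := hk i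
    have hcn : n₁ * c.1 + n₂ * c.2 ≤ n₁ * k.1 + n₂ * k.2 :=
      add_le_add (mul_le_mul_of_nonneg_left h1 hn₁.le) (mul_le_mul_of_nonneg_left h2 hn₂.le)
    have hcneg := hcn.trans_lt hlt
    set θ := (n₁ * k.1 + n₂ * k.2) / (n₁ * c.1 + n₂ * c.2) with hθ
    have hθ0 : 0 ≤ θ := div_nonneg_of_nonpos hlt.le hcneg.le
    have hθ1 : θ ≤ 1 := (div_le_one_of_neg hcneg).2 hcn
    have hθe : θ * (n₁ * c.1 + n₂ * c.2) = n₁ * k.1 + n₂ * k.2 := div_mul_cancel₀ _ hcneg.ne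
    have hcb : |c.1| ≤ |k.1| + |R| := by
      rw [abs_le]
      constructor
      · linarith [neg_abs_le k.1, le_abs_self R]
      · linarith [le_abs_self k.1, abs_nonneg R]
    have hE : |k.1 - θ * c.1| ≤ 2 * |k.1| + |R| := by
      have h5 : |θ * c.1| ≤ |c.1| := by
        rw [abs_mul, abs_of_nonneg hθ0]
        exact mul_le_of_le_one_left (abs_nonneg _) hθ1
      linarith [abs_sub k.1 (θ * c.1)]
    rw [abs_le] at hE
    rcases le_total 0 (k.1 - θ * c.1) with hs | hs
    · refine ⟨c, hc, θ, 0, (k.1 - θ * c.1) / w.1, hθ0, hθ1, le_rfl,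
        div_nonneg (by positivity) (by linarith), by positivity,
        div_le_div_of_nonneg_right hE.2 hw1.le, ?_⟩
      ext
      · simp; field_simp; ring
      · simp
        have : n₂ * (k.2 - θ * c.2 - (k.1 - θ * c.1) / w.1 * w.2) = 0 := by
          field_simp
          linear_combination (-w.1) * hθe - (k.1 - θ * c.1) * hwn0
        rcases mul_eq_zero.1 this with h | h <;> linarith
    · refine ⟨c, hc, θ, (k.1 - θ * c.1) / z.1, 0, hθ0, hθ1,
        div_nonneg_of_nonpos hs hz1.le, ?_, le_rfl, by positivity, ?_⟩
      · rw [← neg_div_neg_eq]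
        exact div_le_div_of_nonneg_right (by linarith) (by linarith)
      have hz1' := hz1.ne
      ext
      · simp; field_simp; ring
      · simp
        have : n₂ * (k.2 - θ * c.2 - (k.1 - θ * c.1) / z.1 * z.2) = 0 := by
          field_simp
          linear_combination (-z.1) * hθe - (k.1 - θ * c.1) * hzn0
        rcases mul_eq_zero.1 this with h | h <;> linarith
  -- Now the cone spanned by `z` and `w` contains the positive quadrant, hence `k - c`; the
  -- coefficients come from Cramer's rule.
  · have hD0 : 0 < w.1 * z.2 - w.2 * z.1 := by
      refine lt_of_le_of_ne ?_ hD.symm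
      have e : n₂ * (w.1 * z.2 - w.2 * z.1) =
          w.1 * (n₁ * z.1 + n₂ * z.2) + (-z.1) * (n₁ * w.1 + n₂ * w.2) := by ring
      have : 0 ≤ n₂ * (w.1 * z.2 - w.2 * z.1) := by
        rw [e]
        exact add_nonneg (mul_nonneg hw1.le hzn) (mul_nonneg (by linarith) hwn)
      exact nonneg_of_mul_nonneg_right this hn₂
    refine ⟨(w.1 - w.2) * |R| / (w.1 * z.2 - w.2 * z.1),
      (z.2 - z.1) * |R| / (w.1 * z.2 - w.2 * z.1),
      div_nonneg (mul_nonneg (by linarith) (abs_nonneg _)) hD0.le,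
      div_nonneg (mul_nonneg (by linarith) (abs_nonneg _)) hD0.le, fun i => ?_⟩
    obtain ⟨c, hc, h1, h2, h3, h4⟩ := hk i
    have hR := le_abs_self R
    refine ⟨c, hc, 1, (w.1 * (k.2 - c.2) - w.2 * (k.1 - c.1)) / (w.1 * z.2 - w.2 * z.1),
      ((k.1 - c.1) * z.2 - (k.2 - c.2) * z.1) / (w.1 * z.2 - w.2 * z.1), zero_le_one, le_rfl,
      div_nonneg (by nlinarith) hD0.le, div_le_div_of_nonneg_right (by nlinarith) hD0.le,
      div_nonneg (by nlinarith) hD0.le, div_le_div_of_nonneg_right (by nlinarith) hD0.le, ?_⟩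
    ext
    · simp; field_simp; ring
    · simp; field_simp; ring

/-- If every point of `K'` is within `δ` of each of the convex sets `C i`, then `K'` stays on the
far side of the line that separates `p` from `⋂ i, C i`, moved by `δ` towards `p`. -/
theorem IsCornerProjection.sep_of_near {ι : Type*} {C : ι → Set (ℝ × ℝ)}
    (hC : ∀ i, Convex ℝ (C i)) {p : ℝ × ℝ} {r s₁ s₂ n₁ n₂ : ℝ}
    (h : IsCornerProjection (⋂ i, C i) p r s₁ s₂ n₁ n₂) (hr : 0 < r) (hp : MemBox (⋂ i, C i) p)
    {k : ℝ × ℝ} {δ : ℝ} (hk : ∀ i, ∃ c ∈ C i, |c.1 - k.1| ≤ δ ∧ |c.2 - k.2| ≤ δ) :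
    (r - δ) * (n₁ + n₂) ≤ n₁ * (s₁ * (k.1 - p.1)) + n₂ * (s₂ * (k.2 - p.2)) := by
  have hs₁' : s₁ * s₁ = 1 := by rcases h.sign₁ with rfl | rfl <;> norm_num
  have hs₂' : s₂ * s₂ = 1 := by rcases h.sign₂ with rfl | rfl <;> norm_num
  have ha1 : |s₁| = 1 := by rcases h.sign₁ with rfl | rfl <;> simp
  have hb1 : |s₂| = 1 := by rcases h.sign₂ with rfl | rfl <;> simp
  -- Coordinates with the corner at the origin, reflected so that the square lies in the negative
  -- quadrant.
  let T : ℝ × ℝ → ℝ × ℝ := fun v => (p.1 + s₁ * (r + v.1), p.2 + s₂ * (r + v.2))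
  let S : ℝ × ℝ → ℝ × ℝ := fun v => (s₁ * (v.1 - p.1) - r, s₂ * (v.2 - p.2) - r)
  have hTS (v) : T (S v) = v := by
    ext
    · simp only [T, S]
      linear_combination (v.1 - p.1) * hs₁'
    · simp only [T, S]
      linear_combination (v.2 - p.2) * hs₂'
  have hsub (a b : ℝ) (s : ℝ) (hs : |s| = 1) (hab : |a - b| ≤ δ) :
      s * a ≤ s * b + δ ∧ s * b - δ ≤ s * a := by
    have : |s * (a - b)| ≤ δ := by rwa [abs_mul, hs, one_mul]
    rw [abs_le] at this
    constructor <;> linarith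
  obtain ⟨z, hz, hz'⟩ := hp.exists_sign_fst h.sign₁
  obtain ⟨w, hw, hw'⟩ := hp.exists_sign_snd h.sign₂
  rw [Set.mem_iInter] at hz hw
  have hmem := h.mem
  rw [Set.mem_iInter] at hmem
  -- Adding `δ` to both coordinates makes `k` dominate every nearby `c`, by at most `2 * δ`.
  have key := separation_of_dominated (C := fun i => T ⁻¹' C i) (n₁ := n₁) (n₂ := n₂)
    (z := S z) (w := S w) (k := ((S k).1 + δ, (S k).2 + δ)) (R := 2 * δ)
    (fun i a ha b hb t u ht hu htu => by
      have := hC i ha hb ht hu htu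
      change T _ ∈ C i
      convert this using 1
      ext
      · simp only [T, Prod.fst_add, Prod.smul_fst, smul_eq_mul]
        linear_combination (-p.1 - s₁ * r) * htu
      · simp only [T, Prod.snd_add, Prod.smul_snd, smul_eq_mul]
        linear_combination (-p.2 - s₂ * r) * htu)
    h.pos₁ h.pos₂
    (fun v hv => by
      have h1 := h.sep hr (T v) (Set.mem_iInter.2 hv)
      have e1 : s₁ * ((T v).1 - p.1) = r + v.1 := by
        simp only [T]; linear_combination (r + v.1) * hs₁'
      have e2 : s₂ * ((T v).2 - p.2) = r + v.2 := by
        simp only [T]; linear_combination (r + v.2) * hs₂'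
      rw [e1, e2] at h1
      linarith)
    (fun i => by
      change T 0 ∈ C i
      have : T 0 = (p.1 + r * s₁, p.2 + r * s₂) := by simp [T, mul_comm]
      rw [this]
      exact hmem i)
    (fun i => by change T (S z) ∈ C i; rw [hTS]; exact hz i)
    (fun i => by change T (S w) ∈ C i; rw [hTS]; exact hw i)
    (by simp only [S]; linarith) (by simp only [S]; linarith)
    (fun i => by
      obtain ⟨c, hc, h1, h2⟩ := hk i
      have h1 := hsub _ _ s₁ ha1 h1
      have h2 := hsub _ _ s₂ hb1 h2
      refine ⟨S c, by change T (S c) ∈ C i; rwa [hTS], ?_, ?_, ?_, ?_⟩ <;> simp only [S] <;>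
        linarith)
  simp only [S] at key
  linarith

/-! ### Stability of the corner projection. -/

/-- One hypothesis suffices, depending on which of `N` and `V` is larger: if `V ≤ N`, then `r * N ≤
(δ - r') * V ≤ (δ - r') * N`. -/
theorem add_le_of_crossed_bounds {r r' N V δ : ℝ} (hr : 0 ≤ r) (hr' : 0 ≤ r') (hN : 0 < N)
    (hV : 0 < V) (h : r' * V ≤ (δ - r) * N) (h' : r * N ≤ (δ - r') * V) : r + r' ≤ δ := by
  rcases le_total V N with hVN | hVN
  · have h0 : 0 ≤ δ - r' := nonneg_of_mul_nonneg_left ((mul_nonneg hr hN.le).trans h') hV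
    have := le_of_mul_le_mul_right (h'.trans (mul_le_mul_of_nonneg_left hVN h0)) hN
    linarith
  · have h0 : 0 ≤ δ - r := nonneg_of_mul_nonneg_left ((mul_nonneg hr' hV.le).trans h) hN
    have := le_of_mul_le_mul_right (h.trans (mul_le_mul_of_nonneg_left hVN h0)) hV
    linarith

/-- The hypothesis `h₂₁` bounds `K₂` by the separating line of `K₁`, and conversely `h₁₂`. -/
theorem IsCornerProjection.abs_sub_snd_le {K₁ K₂ : Set (ℝ × ℝ)} {p₁ p₂ : ℝ × ℝ}
    {r s₁ s₂ n₁ n₂ r' s₁' s₂' n₁' n₂' δ : ℝ}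
    (h₁ : IsCornerProjection K₁ p₁ r s₁ s₂ n₁ n₂)
    (h₂ : IsCornerProjection K₂ p₂ r' s₁' s₂' n₁' n₂') (hp₁ : MemBox K₁ p₁) (hp₂ : MemBox K₂ p₂)
    (hδ : 0 ≤ δ)
    (h₂₁ : 0 < r → ∀ k ∈ K₂,
      (r - δ) * (n₁ + n₂) ≤ n₁ * (s₁ * (k.1 - p₂.1)) + n₂ * (s₂ * (k.2 - p₂.2)))
    (h₁₂ : 0 < r' → ∀ k ∈ K₁,
      (r' - δ) * (n₁' + n₂') ≤ n₁' * (s₁' * (k.1 - p₁.1)) + n₂' * (s₂' * (k.2 - p₁.2))) :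
    |r * s₂ - r' * s₂'| ≤ δ := by
  have hn₁ := h₁.pos₁
  have hn₂ := h₁.pos₂
  have hn₁' := h₂.pos₁
  have hn₂' := h₂.pos₂
  have hr := h₁.nonneg
  have hr' := h₂.nonneg
  have bound {r r' n₁ n₂ a b : ℝ} (hr' : 0 ≤ r') (hn₁ : 0 < n₁) (hn₂ : 0 < n₂)
      (ha : a ≤ 1) (hb : b ≤ 1)
      (h : (r - δ) * (n₁ + n₂) ≤ n₁ * (r' * a) + n₂ * (r' * b)) : r - r' ≤ δ := by
    by_contra! hlt
    have h1 : n₁ * (r' * a) ≤ n₁ * r' :=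
      mul_le_mul_of_nonneg_left (mul_le_of_le_one_right hr' ha) hn₁.le
    have h2 : n₂ * (r' * b) ≤ n₂ * r' :=
      mul_le_mul_of_nonneg_left (mul_le_of_le_one_right hr' hb) hn₂.le
    nlinarith
  have sgn {s s' : ℝ} (h : s = 1 ∨ s = -1) (h' : s' = 1 ∨ s' = -1) :
      s * s' ≤ 1 ∧ (s' = s ∨ s' = -s) ∧ s * s = 1 ∧ |s| = 1 := by
    rcases h with rfl | rfl <;> rcases h' with rfl | rfl <;> norm_num
  obtain ⟨l1, c1, q1, -⟩ := sgn h₁.sign₁ h₂.sign₁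
  obtain ⟨l2, c2, q2, ab2⟩ := sgn h₁.sign₂ h₂.sign₂
  have hle : r - r' ≤ δ := by
    rcases hr.eq_or_lt with h0 | h0
    · linarith
    · have := h₂₁ h0 _ h₂.mem
      simp only at this
      refine bound (a := s₁ * s₁') (b := s₂ * s₂') hr' hn₁ hn₂ l1 l2 (this.trans_eq ?_)
      ring
  have hle' : r' - r ≤ δ := by
    rcases hr'.eq_or_lt with h0 | h0
    · linarith
    · have := h₁₂ h0 _ h₁.mem
      simp only at this
      refine bound (a := s₁ * s₁') (b := s₂ * s₂') hr hn₁' hn₂' l1 l2 (this.trans_eq ?_)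
      ring
  have of_same (h : s₂' = s₂) : |r * s₂ - r' * s₂'| ≤ δ := by
    rw [h, ← sub_mul, abs_mul, ab2, mul_one, abs_le]
    constructor <;> linarith
  rcases c2 with c2 | c2
  · exact of_same c2
  suffices hsum : r + r' ≤ δ by
    have : r * s₂ - r' * s₂' = (r + r') * s₂ := by rw [c2]; ring
    rw [this, abs_mul, ab2, mul_one, abs_of_nonneg (by linarith)]
    exact hsum
  rcases hr.eq_or_lt with h0 | h0
  · linarith
  rcases hr'.eq_or_lt with h0' | h0'
  · linarith
  rcases c1 with c1 | c1
  -- The signs agree in the first coordinate and differ in the second. At `z`, taken from the box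
  -- condition, the first coordinate helps neither functional, so the two lines bound `x` from
  -- opposite sides; `w` does the same for `y`.
  · obtain ⟨z, hz, hz'⟩ := hp₂.exists_sign_fst h₁.sign₁
    obtain ⟨w, hw, hw'⟩ := hp₁.exists_sign_fst h₁.sign₁
    have a1 := h₂.sep h0' z hz
    have a2 := h₂₁ h0 z hz
    have b1 := h₁.sep h0 w hw
    have b2 := h₁₂ h0' w hw
    rw [c1, c2] at a1 b2
    set x := s₂ * (z.2 - p₂.2) with hx
    set y := s₂ * (w.2 - p₁.2) with hy
    have a3 : r' * (n₁' + n₂') ≤ n₂' * (-x) := by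
      have := mul_nonpos_of_nonneg_of_nonpos hn₁'.le hz'
      rw [hx]; linarith
    have a4 : (r - δ) * (n₁ + n₂) ≤ n₂ * x := by
      have := mul_nonpos_of_nonneg_of_nonpos hn₁.le hz'
      linarith
    have b3 : r * (n₁ + n₂) ≤ n₂ * y := by
      have := mul_nonpos_of_nonneg_of_nonpos hn₁.le hw'
      linarith
    have b4 : (r' - δ) * (n₁' + n₂') ≤ n₂' * (-y) := by
      have := mul_nonpos_of_nonneg_of_nonpos hn₁'.le hw'
      rw [hy]; linarith
    set N := (n₁ + n₂) / n₂ with hN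
    set V := (n₁' + n₂') / n₂' with hV
    have hN0 : 0 < N := by positivity
    have hV0 : 0 < V := by positivity
    have a3' : r' * V ≤ -x := by rw [hV, ← mul_div_assoc, div_le_iff₀ hn₂']; linarith
    have a4' : (r - δ) * N ≤ x := by rw [hN, ← mul_div_assoc, div_le_iff₀ hn₂]; linarith
    have b3' : r * N ≤ y := by rw [hN, ← mul_div_assoc, div_le_iff₀ hn₂]; linarith
    have b4' : (r' - δ) * V ≤ -y := by rw [hV, ← mul_div_assoc, div_le_iff₀ hn₂']; linarith
    exact add_le_of_crossed_bounds hr hr' hN0 hV0 (by linarith) (by linarith)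
  · have := h₂₁ h0 _ h₂.mem
    simp only [c1, c2] at this
    have e : n₁ * (s₁ * (p₂.1 + r' * -s₁ - p₂.1)) + n₂ * (s₂ * (p₂.2 + r' * -s₂ - p₂.2))
      = - r' * (n₁ + n₂) := by linear_combination (-n₁ * r') * q1 - n₂ * r' * q2
    rw [e] at this
    have := le_of_mul_le_mul_right this (by positivity)
    linarith

theorem IsCornerProjection.abs_sub_fst_le {K₁ K₂ : Set (ℝ × ℝ)} {p₁ p₂ : ℝ × ℝ}
    {r s₁ s₂ n₁ n₂ r' s₁' s₂' n₁' n₂' δ : ℝ}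
    (h₁ : IsCornerProjection K₁ p₁ r s₁ s₂ n₁ n₂)
    (h₂ : IsCornerProjection K₂ p₂ r' s₁' s₂' n₁' n₂') (hp₁ : MemBox K₁ p₁) (hp₂ : MemBox K₂ p₂)
    (hδ : 0 ≤ δ)
    (h₂₁ : 0 < r → ∀ k ∈ K₂,
      (r - δ) * (n₁ + n₂) ≤ n₁ * (s₁ * (k.1 - p₂.1)) + n₂ * (s₂ * (k.2 - p₂.2)))
    (h₁₂ : 0 < r' → ∀ k ∈ K₁,
      (r' - δ) * (n₁' + n₂') ≤ n₁' * (s₁' * (k.1 - p₁.1)) + n₂' * (s₂' * (k.2 - p₁.2))) :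
    |r * s₁ - r' * s₁'| ≤ δ :=
  h₁.swap.abs_sub_snd_le h₂.swap hp₁.swap hp₂.swap hδ
    (fun h0 k hk => by
      have := h₂₁ h0 k.swap hk
      simp only [Prod.fst_swap, Prod.snd_swap] at this ⊢
      linarith)
    (fun h0 k hk => by
      have := h₁₂ h0 k.swap hk
      simp only [Prod.fst_swap, Prod.snd_swap] at this ⊢
      linarith)

/-- The corner projections of `p₁` and `p₂` on two intersections of convex sets, each of which lies
in the `δ`-neighbourhoods of the sets of the other, are at most `3 δ` apart. -/
theorem IsCornerProjection.abs_sub_le {ι : Type*} {C C' : ι → Set (ℝ × ℝ)}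
    (hC : ∀ i, Convex ℝ (C i)) (hC' : ∀ i, Convex ℝ (C' i)) {p p' : ℝ × ℝ}
    {r s₁ s₂ n₁ n₂ r' s₁' s₂' n₁' n₂' δ : ℝ}
    (h : IsCornerProjection (⋂ i, C i) p r s₁ s₂ n₁ n₂)
    (h' : IsCornerProjection (⋂ i, C' i) p' r' s₁' s₂' n₁' n₂')
    (hp : MemBox (⋂ i, C i) p) (hp' : MemBox (⋂ i, C' i) p')
    (hd₁ : |p.1 - p'.1| ≤ δ) (hd₂ : |p.2 - p'.2| ≤ δ)
    (hnear : ∀ k ∈ ⋂ i, C' i, ∀ i, ∃ c ∈ C i, |c.1 - k.1| ≤ δ ∧ |c.2 - k.2| ≤ δ)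
    (hnear' : ∀ k ∈ ⋂ i, C i, ∀ i, ∃ c ∈ C' i, |c.1 - k.1| ≤ δ ∧ |c.2 - k.2| ≤ δ) :
    |(p.1 + r * s₁) - (p'.1 + r' * s₁')| ≤ 3 * δ ∧ |(p.2 + r * s₂) - (p'.2 + r' * s₂')| ≤ 3 * δ := by
  have hδ : 0 ≤ δ := (abs_nonneg _).trans hd₁
  have shift {s a b δ : ℝ} (hs : s = 1 ∨ s = -1) (hab : |a - b| ≤ δ) (c : ℝ) :
      s * (c - a) ≤ s * (c - b) + δ := by
    rw [abs_le] at hab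
    rcases hs with rfl | rfl <;> linarith
  -- One `δ` comes from nearness of the sets, the other from replacing `p` by `p'`.
  have h₂₁ (h0 : 0 < r) (k) (hk : k ∈ ⋂ i, C' i) :
      (r - 2 * δ) * (n₁ + n₂) ≤ n₁ * (s₁ * (k.1 - p'.1)) + n₂ * (s₂ * (k.2 - p'.2)) := by
    have := h.sep_of_near hC h0 hp (hnear k hk)
    have e1 := mul_le_mul_of_nonneg_left (shift h.sign₁ hd₁ k.1) h.pos₁.le
    have e2 := mul_le_mul_of_nonneg_left (shift h.sign₂ hd₂ k.2) h.pos₂.le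
    linarith
  have h₁₂ (h0 : 0 < r') (k) (hk : k ∈ ⋂ i, C i) :
      (r' - 2 * δ) * (n₁' + n₂') ≤ n₁' * (s₁' * (k.1 - p.1)) + n₂' * (s₂' * (k.2 - p.2)) := by
    have := h'.sep_of_near hC' h0 hp' (hnear' k hk)
    rw [abs_sub_comm] at hd₁ hd₂
    have e1 := mul_le_mul_of_nonneg_left (shift h'.sign₁ hd₁ k.1) h'.pos₁.le
    have e2 := mul_le_mul_of_nonneg_left (shift h'.sign₂ hd₂ k.2) h'.pos₂.le
    linarith
  have k1 := h.abs_sub_fst_le h' hp hp' (by positivity) h₂₁ h₁₂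
  have k2 := h.abs_sub_snd_le h' hp hp' (by positivity) h₂₁ h₁₂
  rw [abs_le] at hd₁ hd₂ k1 k2
  constructor <;> rw [abs_le] <;> constructor <;> linarith

/-! ### Helly's theorem and Lipschitz extension. -/

/-- Helly's theorem in the plane handles finite subfamilies; compactness of one member passes to the
whole family. -/
theorem nonempty_iInter_of_triple {ι : Type*} {C : ι → Set (ℝ × ℝ)} (hconv : ∀ i, Convex ℝ (C i))
    (hclosed : ∀ i, IsClosed (C i)) {i₀ : ι} (hcomp : IsCompact (C i₀))
    (h : ∀ i j k, (C i ∩ C j ∩ C k).Nonempty) : (⋂ i, C i).Nonempty := by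
  classical
  have hfin (s : Finset ι) : (⋂ i ∈ s, C i).Nonempty := by
    refine Convex.helly_theorem' (𝕜 := ℝ) (fun i _ => hconv i) fun I _ hI => ?_
    have hI : I.card ≤ 3 := by simpa using hI
    have : ∃ i j k, I ⊆ {i, j, k} := by
      interval_cases hc : I.card
      · rw [Finset.card_eq_zero] at hc
        exact ⟨i₀, i₀, i₀, by simp [hc]⟩
      · obtain ⟨i, rfl⟩ := Finset.card_eq_one.1 hc
        exact ⟨i, i, i, by simp⟩
      · obtain ⟨i, j, -, rfl⟩ := Finset.card_eq_two.1 hc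
        exact ⟨i, j, j, by simp⟩
      · obtain ⟨i, j, k, -, -, -, rfl⟩ := Finset.card_eq_three.1 hc
        exact ⟨i, j, k, subset_rfl⟩
    obtain ⟨i, j, k, hsub⟩ := this
    obtain ⟨v, ⟨hi, hj⟩, hk⟩ := h i j k
    refine ⟨v, Set.mem_iInter₂.2 fun l hl => ?_⟩
    have := hsub hl
    simp only [Finset.mem_insert, Finset.mem_singleton] at this
    rcases this with rfl | rfl | rfl <;> assumption
  have := hcomp.inter_iInter_nonempty C hclosed fun s => by
    obtain ⟨v, hv⟩ := hfin (insert i₀ s)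
    simp only [Finset.mem_insert, Set.iInter_iInter_eq_or_left] at hv
    exact ⟨v, hv⟩
  exact this.mono Set.inter_subset_right

section

variable {M : Type*} [PseudoEMetricSpace M]

/-- A real function of Lipschitz constant one with prescribed lower and upper bounds. -/
theorem exists_between_of_le_add_edist {ι : Type*} (u : ι → M) (a b : ι → ℝ)
    (h : ∀ i j, edist (u i) (u j) ≠ ⊤ → a i ≤ b j + (edist (u i) (u j)).toReal) :
    ∃ g : M → ℝ, (∀ i, a i ≤ g (u i) ∧ g (u i) ≤ b i) ∧
      ∀ x y, edist x y ≠ ⊤ → |g x - g y| ≤ (edist x y).toReal := by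
  -- McShane's formula over indices at finite distance. Where there are none the supremum is 0, and
  -- this happens on whole classes of points at finite distance from each other.
  let g : M → ℝ := fun x => ⨆ i : {i : ι // edist x (u i) ≠ ⊤}, (a i - (edist x (u i)).toReal)
  have tri {x y z : M} (hxy : edist x y ≠ ⊤) (hyz : edist y z ≠ ⊤) :
      (edist x z).toReal ≤ (edist x y).toReal + (edist y z).toReal := by
    rw [← ENNReal.toReal_add hxy hyz]
    exact ENNReal.toReal_mono (ENNReal.add_ne_top.2 ⟨hxy, hyz⟩) (edist_triangle x y z)
  have fin {x y z : M} (hxy : edist x y ≠ ⊤) (hyz : edist y z ≠ ⊤) : edist x z ≠ ⊤ :=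
    ne_top_of_le_ne_top (ENNReal.add_ne_top.2 ⟨hxy, hyz⟩) (edist_triangle x y z)
  have ub {x : M} {j : ι} (hj : edist x (u j) ≠ ⊤) (i : {i : ι // edist x (u i) ≠ ⊤}) :
      a i - (edist x (u i)).toReal ≤ b j + (edist x (u j)).toReal := by
    have hi := i.2
    rw [edist_comm] at hi
    have h1 := h i j (fin hi hj)
    have h2 := tri hi hj
    rw [edist_comm (u i) x] at h2
    linarith
  have bdd (x : M) : BddAbove (Set.range fun i : {i : ι // edist x (u i) ≠ ⊤} =>
      a i - (edist x (u i)).toReal) := by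
    rcases isEmpty_or_nonempty {i : ι // edist x (u i) ≠ ⊤} with he | ⟨⟨j, hj⟩⟩
    · simp
    · exact ⟨_, Set.forall_mem_range.2 (ub hj)⟩
  refine ⟨g, fun i => ?_, fun x y hxy => ?_⟩
  · have hi : edist (u i) (u i) ≠ ⊤ := by simp
    have : Nonempty {j : ι // edist (u i) (u j) ≠ ⊤} := ⟨⟨i, hi⟩⟩
    constructor
    · simpa using le_ciSup (bdd (u i)) ⟨i, hi⟩
    · simpa using ciSup_le (ub hi)
  · have one {x y : M} (hxy : edist x y ≠ ⊤) : g x ≤ g y + (edist x y).toReal := by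
      have hyx : edist y x ≠ ⊤ := by rwa [edist_comm]
      rcases isEmpty_or_nonempty {i : ι // edist x (u i) ≠ ⊤} with he | hne
      · have : IsEmpty {i : ι // edist y (u i) ≠ ⊤} := ⟨fun i => he.false ⟨i, fin hxy i.2⟩⟩
        simp only [g, Real.iSup_of_isEmpty]
        simp
      · refine ciSup_le fun i => ?_
        have h1 := le_ciSup (bdd y) ⟨i, fin hyx i.2⟩
        have h2 := tri hyx i.2
        rw [edist_comm y x] at h2
        change _ ≤ g y at h1
        simp only at h1
        linarith
    have h1 := one hxy
    have h2 := one (x := y) (y := x) (by rwa [edist_comm])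
    rw [edist_comm y x] at h2
    rw [abs_le]
    constructor <;> linarith

theorem edist_prod_le_iff {p q : ℝ × ℝ} {d : ℝ≥0∞} (hd : d ≠ ⊤) :
    edist p q ≤ d ↔ |p.1 - q.1| ≤ d.toReal ∧ |p.2 - q.2| ≤ d.toReal := by
  rw [edist_dist, ENNReal.ofReal_le_iff_le_toReal hd, Prod.dist_eq, max_le_iff, Real.dist_eq,
    Real.dist_eq]

/-- Maps into the plane with the maximum norm extend with the same Lipschitz constant. -/
theorem exists_extension_of_edist_le {ι : Type*} (u : ι → M) (f : ι → ℝ × ℝ)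
    (h : ∀ i j, edist (f i) (f j) ≤ edist (u i) (u j)) :
    ∃ g : M → ℝ × ℝ, (∀ i, g (u i) = f i) ∧ ∀ x y, edist (g x) (g y) ≤ edist x y := by
  obtain ⟨g₁, h₁, h₁'⟩ := exists_between_of_le_add_edist u (fun i => (f i).1) (fun i => (f i).1)
    fun i j hij => by
      have := ((edist_prod_le_iff hij).1 (h i j)).1
      linarith [le_abs_self ((f i).1 - (f j).1)]
  obtain ⟨g₂, h₂, h₂'⟩ := exists_between_of_le_add_edist u (fun i => (f i).2) (fun i => (f i).2)
    fun i j hij => by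
      have := ((edist_prod_le_iff hij).1 (h i j)).2
      linarith [le_abs_self ((f i).2 - (f j).2)]
  refine ⟨fun x => (g₁ x, g₂ x), fun i => ?_, fun x y => ?_⟩
  · ext
    · exact le_antisymm (h₁ i).2 (h₁ i).1
    · exact le_antisymm (h₂ i).2 (h₂ i).1
  · rcases eq_or_ne (edist x y) ⊤ with hxy | hxy
    · rw [hxy]; exact le_top
    · exact (edist_prod_le_iff hxy).2 ⟨h₁' x y hxy, h₂' x y hxy⟩

/-! ### Enlargements, and the use of the four points. -/

/-- The points whose distance to `F u` is at most the distance from `x` to `u`. -/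
def enlargement (F : M → Set (ℝ × ℝ)) (x u : M) : Set (ℝ × ℝ) :=
  {c | Metric.infEDist c (F u) ≤ edist x u}

variable {F : M → Set (ℝ × ℝ)}

theorem isClosed_enlargement (x u : M) : IsClosed (enlargement F x u) :=
  isClosed_le Metric.continuous_infEDist continuous_const

theorem convex_enlargement (hF : ∀ x, Convex ℝ (F x)) (x u : M) :
    Convex ℝ (enlargement F x u) := by
  rcases eq_or_ne (edist x u) ⊤ with h | h
  · have : enlargement F x u = Set.univ := by
      ext; simp [enlargement, h]
    rw [this]
    exact convex_univ
  · have : enlargement F x u = Metric.cthickening (edist x u).toReal (F u) := by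
      ext
      rw [Metric.mem_cthickening_iff, ENNReal.ofReal_toReal h]
      rfl
    rw [this]
    exact (hF u).cthickening _

theorem enlargement_self (hF : ∀ x, IsClosed (F x)) (x : M) : enlargement F x x = F x := by
  ext c
  rw [← (hF x).closure_eq, Metric.mem_closure_iff_infEDist_zero]
  simp [enlargement]

/-- The distance from `k` to its nearest point in `F u` is at most ρ(x, y) + ρ(x, u), and an
intermediate point splits it accordingly. -/
theorem exists_mem_enlargement_of_mem (hF : ∀ x, IsCompact (F x)) (hne : ∀ x, (F x).Nonempty)
    {x y u : M} (hxy : edist x y ≠ ⊤) {k : ℝ × ℝ} (hk : k ∈ enlargement F y u) :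
    ∃ c ∈ enlargement F x u,
      |c.1 - k.1| ≤ (edist x y).toReal ∧ |c.2 - k.2| ≤ (edist x y).toReal := by
  rcases eq_or_ne (edist x u) ⊤ with h | h
  · exact ⟨k, by simp [enlargement, h], by simp, by simp⟩
  obtain ⟨v, hv, hkv⟩ := (hF u).exists_infEDist_eq_edist (hne u) k
  have h1 : edist k v ≤ edist x y + edist x u := by
    rw [← hkv, edist_comm x y]
    exact (show Metric.infEDist k (F u) ≤ edist y u from hk).trans (edist_triangle _ _ _)
  rw [edist_dist, ENNReal.ofReal_le_iff_le_toReal (ENNReal.add_ne_top.2 ⟨hxy, h⟩),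
    ENNReal.toReal_add hxy h, add_comm] at h1
  obtain ⟨c, hc1, hc2⟩ := exists_dist_le_le ENNReal.toReal_nonneg ENNReal.toReal_nonneg h1
  refine ⟨c, ?_, ?_⟩
  · refine (Metric.infEDist_le_edist_of_mem hv).trans ?_
    rwa [edist_dist, ENNReal.ofReal_le_iff_le_toReal h]
  · rwa [dist_comm, Prod.dist_eq, max_le_iff, Real.dist_eq, Real.dist_eq] at hc1

/-- Every restriction of `F` to four points has a selection of Lipschitz constant one. -/
def HasFourPointSelections (F : M → Set (ℝ × ℝ)) : Prop :=
  ∀ u : Fin 4 → M, ∃ f : Fin 4 → ℝ × ℝ, (∀ i, f i ∈ F (u i)) ∧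
    ∀ i j, edist (f i) (f j) ≤ edist (u i) (u j)

/-- Extending the selection to all of `M` serves every centre `x` at once, so centres do not count
among the four points. -/
theorem HasFourPointSelections.exists_mem_enlargement (h : HasFourPointSelections F)
    (u : Fin 4 → M) : ∃ g : M → ℝ × ℝ, (∀ x y, edist (g x) (g y) ≤ edist x y) ∧
      ∀ x i, g x ∈ enlargement F x (u i) := by
  obtain ⟨f, hf, hd⟩ := h u
  obtain ⟨g, hg, hg'⟩ := exists_extension_of_edist_le u f hd
  refine ⟨g, hg', fun x i => ?_⟩
  have : g (u i) ∈ F (u i) := hg i ▸ hf i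
  exact (Metric.infEDist_le_edist_of_mem this).trans (hg' x (u i))

/-- Triples of enlargements always meet, so Helly only has to test pairs against `H`.
Contrapositively, if `H` misses the whole intersection, it already misses that of two enlargements.
-/
theorem HasFourPointSelections.nonempty_iInter_inter (h : HasFourPointSelections F)
    (hconv : ∀ x, Convex ℝ (F x)) (hcomp : ∀ x, IsCompact (F x)) {x : M} {H : Set (ℝ × ℝ)}
    (hH : Convex ℝ H) (hH' : IsClosed H)
    (hmeet : ∀ u v, (enlargement F x u ∩ enlargement F x v ∩ H).Nonempty) :
    ((⋂ u, enlargement F x u) ∩ H).Nonempty := by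
  let C : Option M → Set (ℝ × ℝ) := fun o => o.elim H (enlargement F x)
  have key : (⋂ o, C o).Nonempty := by
    refine nonempty_iInter_of_triple (i₀ := some x) ?_ ?_ ?_ ?_
    · rintro (_ | u)
      exacts [hH, convex_enlargement hconv x u]
    · rintro (_ | u)
      exacts [hH', isClosed_enlargement x u]
    · change IsCompact (enlargement F x x)
      rw [enlargement_self fun x => (hcomp x).isClosed]
      exact hcomp x
    · have meet (u v) : ∃ c, c ∈ enlargement F x u ∧ c ∈ enlargement F x v ∧ c ∈ H :=
        let ⟨c, ⟨h1, h2⟩, h3⟩ := hmeet u v; ⟨c, h1, h2, h3⟩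
      rintro (_ | u) (_ | v) (_ | w)
      · obtain ⟨c, h1, h2, h3⟩ := meet x x
        exact ⟨c, ⟨h3, h3⟩, h3⟩
      · obtain ⟨c, h1, h2, h3⟩ := meet w w
        exact ⟨c, ⟨h3, h3⟩, h1⟩
      · obtain ⟨c, h1, h2, h3⟩ := meet v v
        exact ⟨c, ⟨h3, h1⟩, h3⟩
      · obtain ⟨c, h1, h2, h3⟩ := meet v w
        exact ⟨c, ⟨h3, h1⟩, h2⟩
      · obtain ⟨c, h1, h2, h3⟩ := meet u u
        exact ⟨c, ⟨h1, h3⟩, h3⟩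
      · obtain ⟨c, h1, h2, h3⟩ := meet u w
        exact ⟨c, ⟨h1, h3⟩, h2⟩
      · obtain ⟨c, h1, h2, h3⟩ := meet u v
        exact ⟨c, ⟨h1, h2⟩, h3⟩
      · obtain ⟨g, -, hg⟩ := h.exists_mem_enlargement ![u, v, w, w]
        exact ⟨g x, ⟨hg x 0, hg x 1⟩, hg x 2⟩
  obtain ⟨c, hc⟩ := key
  rw [Set.mem_iInter] at hc
  exact ⟨c, Set.mem_iInter.2 fun u => hc (some u), hc none⟩

theorem HasFourPointSelections.nonempty_iInter (h : HasFourPointSelections F)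
    (hconv : ∀ x, Convex ℝ (F x)) (hcomp : ∀ x, IsCompact (F x)) (x : M) :
    (⋂ u, enlargement F x u).Nonempty := by
  refine (h.nonempty_iInter_inter hconv hcomp (x := x) convex_univ isClosed_univ
    fun u v => ?_).mono Set.inter_subset_left
  obtain ⟨g, -, hg⟩ := h.exists_mem_enlargement ![u, v, v, v]
  exact ⟨g x, ⟨hg x 0, hg x 1⟩, trivial⟩

theorem isCompact_iInter_enlargement (hcomp : ∀ x, IsCompact (F x)) (x : M) :
    IsCompact (⋂ u, enlargement F x u) :=
  (hcomp x).of_isClosed_subset (isClosed_iInter fun u => isClosed_enlargement x u) <| by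
    rw [← enlargement_self (fun x => (hcomp x).isClosed) x]
    exact Set.iInter_subset _ x

theorem HasFourPointSelections.exists_le_add (h : HasFourPointSelections F)
    (hconv : ∀ x, Convex ℝ (F x)) (hcomp : ∀ x, IsCompact (F x))
    (π : (ℝ × ℝ) →L[ℝ] ℝ) (hπ : ∀ v, |π v| ≤ ‖v‖) {y z : M} (hyz : edist y z ≠ ⊤) :
    ∃ p ∈ ⋂ u, enlargement F y u, ∃ q ∈ ⋂ u, enlargement F z u,
      π p ≤ π q + (edist y z).toReal := by
  obtain ⟨p, hp, hpm⟩ := (isCompact_iInter_enlargement hcomp y).exists_isMinOn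
    (h.nonempty_iInter hconv hcomp y) π.continuous.continuousOn
  obtain ⟨q, hq, hqm⟩ := (isCompact_iInter_enlargement hcomp z).exists_isMaxOn
    (h.nonempty_iInter hconv hcomp z) π.continuous.continuousOn
  refine ⟨p, hp, q, hq, ?_⟩
  set δ := (edist y z).toReal
  by_contra! hlt
  -- Each threshold takes a third of the excess `π p - π q - δ`; the two still differ by more than
  -- `δ`.
  have hy : ∃ u v, ∀ c, c ∈ enlargement F y u → c ∈ enlargement F y v →
      (2 * π p + π q + δ) / 3 < π c := by
    by_contra! hcon
    obtain ⟨c, hc, hc'⟩ := h.nonempty_iInter_inter hconv hcomp (x := y)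
      (H := {c | π c ≤ (2 * π p + π q + δ) / 3})
      (convex_halfSpace_le π.toLinearMap.isLinear _) (isClosed_le π.continuous continuous_const)
      fun u v => let ⟨c, h1, h2, h3⟩ := hcon u v; ⟨c, ⟨h1, h2⟩, h3⟩
    have h1 : π p ≤ π c := hpm hc
    have h2 : π c ≤ (2 * π p + π q + δ) / 3 := hc'
    linarith
  have hz : ∃ u v, ∀ c, c ∈ enlargement F z u → c ∈ enlargement F z v →
      π c < (π p + 2 * π q - δ) / 3 := by
    by_contra! hcon
    obtain ⟨c, hc, hc'⟩ := h.nonempty_iInter_inter hconv hcomp (x := z)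
      (H := {c | (π p + 2 * π q - δ) / 3 ≤ π c})
      (convex_halfSpace_ge π.toLinearMap.isLinear _) (isClosed_le continuous_const π.continuous)
      fun u v => let ⟨c, h1, h2, h3⟩ := hcon u v; ⟨c, ⟨h1, h2⟩, h3⟩
    have h1 : π c ≤ π q := hqm hc
    have h2 : (π p + 2 * π q - δ) / 3 ≤ π c := hc'
    linarith
  obtain ⟨u₁, u₂, hu⟩ := hy
  obtain ⟨v₁, v₂, hv⟩ := hz
  obtain ⟨g, hg, hg'⟩ := h.exists_mem_enlargement ![u₁, u₂, v₁, v₂]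
  have h1 := hu (g y) (hg' y 0) (hg' y 1)
  have h2 := hv (g z) (hg' z 2) (hg' z 3)
  have h3 : dist (g y) (g z) ≤ δ := by
    have := hg y z
    rwa [edist_dist, ENNReal.ofReal_le_iff_le_toReal hyz] at this
  have h4 := (le_abs_self _).trans ((hπ (g y - g z)).trans (dist_eq_norm (g y) (g z) ▸ h3))
  rw [map_sub] at h4
  linarith

theorem HasFourPointSelections.exists_coordinate (h : HasFourPointSelections F)
    (hconv : ∀ x, Convex ℝ (F x)) (hcomp : ∀ x, IsCompact (F x))
    (π : (ℝ × ℝ) →L[ℝ] ℝ) (hπ : ∀ v, |π v| ≤ ‖v‖) :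
    ∃ g : M → ℝ, (∀ x y, edist x y ≠ ⊤ → |g x - g y| ≤ (edist x y).toReal) ∧
      ∀ x, (∃ k ∈ ⋂ u, enlargement F x u, π k ≤ g x) ∧
        ∃ k ∈ ⋂ u, enlargement F x u, g x ≤ π k := by
  choose p hp hpm using fun x => (isCompact_iInter_enlargement hcomp x).exists_isMinOn
    (h.nonempty_iInter hconv hcomp x) π.continuous.continuousOn
  choose q hq hqm using fun x => (isCompact_iInter_enlargement hcomp x).exists_isMaxOn
    (h.nonempty_iInter hconv hcomp x) π.continuous.continuousOn
  obtain ⟨g, hg, hg'⟩ := exists_between_of_le_add_edist id (fun x => π (p x)) (fun x => π (q x))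
    fun x y hxy => by
      obtain ⟨k, hk, l, hl, hkl⟩ := h.exists_le_add hconv hcomp π hπ (y := x) (z := y) hxy
      exact (hpm x hk).trans (hkl.trans (add_le_add_left (hqm y hl) _))
  exact ⟨g, hg', fun x => ⟨⟨p x, hp x, (hg x).1⟩, ⟨q x, hq x, (hg x).2⟩⟩⟩

theorem HasFourPointSelections.exists_selection (h : HasFourPointSelections F)
    (hconv : ∀ x, Convex ℝ (F x)) (hcomp : ∀ x, IsCompact (F x)) :
    ∃ f : M → ℝ × ℝ, (∀ x, f x ∈ F x) ∧ ∀ x y, edist (f x) (f y) ≤ 3 * edist x y := by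
  have hne (x : M) : (F x).Nonempty := let ⟨f, hf, _⟩ := h fun _ => x; ⟨f 0, hf 0⟩
  obtain ⟨g₁, h₁, hb₁⟩ := h.exists_coordinate hconv hcomp (ContinuousLinearMap.fst ℝ ℝ ℝ)
    norm_fst_le
  obtain ⟨g₂, h₂, hb₂⟩ := h.exists_coordinate hconv hcomp (ContinuousLinearMap.snd ℝ ℝ ℝ)
    norm_snd_le
  have hbox (x : M) : MemBox (⋂ u, enlargement F x u) (g₁ x, g₂ x) :=
    ⟨(hb₁ x).1, (hb₁ x).2, (hb₂ x).1, (hb₂ x).2⟩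
  choose r s₁ s₂ n₁ n₂ hP using fun x => exists_isCornerProjection
    (isCompact_iInter_enlargement hcomp x)
    (convex_iInter fun u => convex_enlargement hconv x u) (hbox x)
  refine ⟨fun x => (g₁ x + r x * s₁ x, g₂ x + r x * s₂ x), fun x => ?_, fun x y => ?_⟩
  · rw [← enlargement_self (fun x => (hcomp x).isClosed) x]
    exact Set.mem_iInter.1 (hP x).mem x
  rcases eq_or_ne (edist x y) ⊤ with hxy | hxy
  · simp [hxy]
  have hyx : edist y x ≠ ⊤ := by rwa [edist_comm]
  rw [edist_prod_le_iff (ENNReal.mul_ne_top (by simp) hxy), ENNReal.toReal_mul]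
  simp only [ENNReal.toReal_ofNat]
  refine (hP x).abs_sub_le (convex_enlargement hconv x) (convex_enlargement hconv y) (hP y)
    (hbox x) (hbox y) (h₁ x y hxy) (h₂ x y hxy) (fun k hk u => ?_) fun k hk u => ?_
  · exact exists_mem_enlargement_of_mem hcomp hne hxy (Set.mem_iInter.1 hk u)
  · rw [edist_comm]
    exact exists_mem_enlargement_of_mem hcomp hne hyx (Set.mem_iInter.1 hk u)

end

/-! ### The seminorm, rescaling, and passage to a general plane. -/

theorem enorm_sub_le_of_lipSeminorm_le {M X : Type*} [PseudoEMetricSpace M]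
    [NormedAddCommGroup X] {f : M → X} {c : ℝ≥0} (hc : 0 < c) (h : lipSeminorm f ≤ c) (x y : M) :
    ‖f x - f y‖ₑ ≤ c * edist x y := by
  rcases eq_or_ne (edist x y) ⊤ with hxy | hxy
  · rw [hxy, ENNReal.mul_top (by simpa using hc.ne')]
    exact le_top
  refine ENNReal.le_of_forall_pos_le_add fun ε hε _ => ?_
  have hη : 0 < ε / ((edist x y).toNNReal + 1) := by positivity
  set η := ε / ((edist x y).toNNReal + 1) with hηd
  have hlt : lipSeminorm f < ((c + η : ℝ≥0) : ℝ≥0∞) :=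
    h.trans_lt (by exact_mod_cast lt_add_of_pos_right c hη)
  simp only [lipSeminorm, iInf_lt_iff] at hlt
  obtain ⟨K, -, hK, hlt⟩ := hlt
  have h1 : (η : ℝ≥0∞) * edist x y ≤ ε := by
    rw [← ENNReal.coe_toNNReal hxy]
    norm_cast
    rw [hηd, div_mul_eq_mul_div, div_le_iff₀ (by positivity)]
    gcongr
    exact le_self_add
  calc ‖f x - f y‖ₑ ≤ K * edist x y := hK x y
    _ ≤ ((c + η : ℝ≥0) : ℝ≥0∞) * edist x y := by gcongr
    _ = c * edist x y + η * edist x y := by rw [ENNReal.coe_add, add_mul]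
    _ ≤ c * edist x y + ε := by gcongr

theorem lipSeminorm_le_of_enorm_sub_le {M X : Type*} [PseudoEMetricSpace M]
    [NormedAddCommGroup X] {f : M → X} {c : ℝ≥0} (hc : 0 < c)
    (h : ∀ x y, ‖f x - f y‖ₑ ≤ c * edist x y) : lipSeminorm f ≤ c :=
  iInf_le_of_le c (iInf_le_of_le hc (iInf_le _ h))

/-- The distance multiplied by a factor `c`. -/
noncomputable abbrev PseudoEMetricSpace.rescale {M : Type*} (m : PseudoEMetricSpace M) (c : ℝ≥0) :
    PseudoEMetricSpace M where
  edist x y := c * edist x y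
  edist_self x := by simp
  edist_comm x y := by rw [edist_comm]
  edist_triangle x y z := by
    rw [← mul_add]
    gcongr
    exact edist_triangle x y z

/-- A two-dimensional space with an Auerbach basis is at distance at most two from the plane with
the maximum norm. -/
theorem exists_linearEquiv_prod_of_finrank_eq_two {X : Type*} [NormedAddCommGroup X]
    [NormedSpace ℝ X] (hX : Module.finrank ℝ X = 2) :
    ∃ e : X ≃ₗ[ℝ] ℝ × ℝ, ∀ x, ‖e x‖ ≤ ‖x‖ ∧ ‖x‖ ≤ 2 * ‖e x‖ := by
  have : FiniteDimensional ℝ X := Module.finite_of_finrank_eq_succ hX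
  have : ProperSpace X := FiniteDimensional.proper ℝ X
  obtain ⟨b⟩ : Nonempty (X ≃L[ℝ] (Fin 2 → ℝ)) := ⟨(Module.finBasisOfFinrankEq ℝ X hX).equivFunL⟩
  obtain ⟨D, hD⟩ : ∃ D : X → X → ℝ, ∀ x y, D x y = b x 0 * b y 1 - b x 1 * b y 0 :=
    ⟨_, fun _ _ => rfl⟩
  have hDc : Continuous fun q : X × X => D q.1 q.2 := by
    simp only [hD]
    fun_prop
  have hcomp : IsCompact (Metric.closedBall (0 : X) 1 ×ˢ Metric.closedBall (0 : X) 1) :=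
    (isCompact_closedBall _ _).prod (isCompact_closedBall _ _)
  -- A pair of largest area in the unit ball is an Auerbach basis: replacing one vector by a unit
  -- vector of either sign cannot increase `D`, so both coordinate functionals have norm at most
  -- one.
  obtain ⟨⟨e₁, e₂⟩, ⟨he₁, he₂⟩, hmax⟩ := hcomp.exists_isMaxOn ⟨(0, 0), by simp⟩ hDc.continuousOn
  simp only [mem_closedBall_zero_iff] at he₁ he₂
  have hmax' (x y : X) (hx : ‖x‖ ≤ 1) (hy : ‖y‖ ≤ 1) : D x y ≤ D e₁ e₂ :=
    hmax (show (x, y) ∈ Metric.closedBall (0 : X) 1 ×ˢ Metric.closedBall (0 : X) 1 by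
      simp [hx, hy])
  have hsmul₁ (c : ℝ) (x y : X) : D (c • x) y = c * D x y := by
    simp only [hD, map_smul, Pi.smul_apply, smul_eq_mul]; ring
  have hsmul₂ (c : ℝ) (x y : X) : D x (c • y) = c * D x y := by
    simp only [hD, map_smul, Pi.smul_apply, smul_eq_mul]; ring
  have hadd₁ (x x' y : X) : D (x + x') y = D x y + D x' y := by
    simp only [hD, map_add, Pi.add_apply]; ring
  have hadd₂ (x y y' : X) : D x (y + y') = D x y + D x y' := by
    simp only [hD, map_add, Pi.add_apply]; ring
  have hunit (x : X) (hx : x ≠ 0) : ‖(‖x‖⁻¹) • x‖ ≤ 1 := by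
    rw [norm_smul, norm_inv, norm_norm, inv_mul_cancel₀ (norm_ne_zero_iff.2 hx)]
  have hΔ : 0 < D e₁ e₂ := by
    let x := b.symm (Pi.single 0 1)
    let y := b.symm (Pi.single 1 1)
    have hxy : D x y = 1 := by simp [hD, x, y]
    have hx : x ≠ 0 := by
      intro h
      rw [h] at hxy
      simp [hD] at hxy
    have hy : y ≠ 0 := by
      intro h
      rw [h] at hxy
      simp [hD] at hxy
    refine lt_of_lt_of_le ?_ (hmax' _ _ (hunit x hx) (hunit y hy))
    rw [hsmul₁, hsmul₂, hxy]
    have := norm_pos_iff.2 hx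
    have := norm_pos_iff.2 hy
    positivity
  set Δ := D e₁ e₂ with hΔd
  have hb₁ (x : X) : |D x e₂| ≤ Δ * ‖x‖ := by
    rcases eq_or_ne x 0 with rfl | hx
    · simp [hD]
    have h1 := hmax' _ _ (hunit x hx) he₂
    have h2 := hmax' (-(‖x‖⁻¹) • x) e₂ (by rw [neg_smul, norm_neg]; exact hunit x hx) he₂
    rw [hsmul₁] at h1 h2
    have hn := norm_pos_iff.2 hx
    rw [inv_mul_le_iff₀ hn] at h1
    rw [neg_mul, ← mul_neg, inv_mul_le_iff₀ hn] at h2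
    rw [abs_le]
    constructor <;> linarith
  have hb₂ (x : X) : |D e₁ x| ≤ Δ * ‖x‖ := by
    rcases eq_or_ne x 0 with rfl | hx
    · simp [hD]
    have h1 := hmax' _ _ he₁ (hunit x hx)
    have h2 := hmax' e₁ (-(‖x‖⁻¹) • x) he₁ (by rw [neg_smul, norm_neg]; exact hunit x hx)
    rw [hsmul₂] at h1 h2
    have hn := norm_pos_iff.2 hx
    rw [inv_mul_le_iff₀ hn] at h1
    rw [neg_mul, ← mul_neg, inv_mul_le_iff₀ hn] at h2
    rw [abs_le]
    constructor <;> linarith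
  have hself (x : X) : D x x = 0 := by simp only [hD]; ring
  -- Cramer's rule.
  have hrep (x : X) : (D x e₂ / Δ) • e₁ + (D e₁ x / Δ) • e₂ = x := by
    apply b.injective
    ext i
    simp only [map_add, map_smul, Pi.add_apply, Pi.smul_apply, smul_eq_mul]
    rw [div_mul_eq_mul_div, div_mul_eq_mul_div, ← add_div, div_eq_iff hΔ.ne']
    fin_cases i
    · simp only [hΔd, hD, Fin.zero_eta]; ring
    · simp only [hΔd, hD, Fin.mk_one]; ring
  let e : X ≃ₗ[ℝ] ℝ × ℝ :=
    { toFun := fun x => (D x e₂ / Δ, D e₁ x / Δ)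
      map_add' := fun x y => by ext <;> simp only [hadd₁, hadd₂, add_div, Prod.mk_add_mk]
      map_smul' := fun c x => by
        ext <;> simp [hsmul₁, hsmul₂, mul_div_assoc]
      invFun := fun v => v.1 • e₁ + v.2 • e₂
      left_inv := hrep
      right_inv := fun v => by
        ext
        · simp [hadd₁, hsmul₁, hself, ← hΔd, hΔ.ne']
        · simp [hadd₂, hsmul₂, hself, ← hΔd, hΔ.ne'] }
  have he (x : X) : ‖e x‖ = max |D x e₂ / Δ| |D e₁ x / Δ| := rfl
  refine ⟨e, fun x => ⟨?_, ?_⟩⟩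
  · rw [he, abs_div, abs_div, abs_of_pos hΔ]
    exact max_le ((div_le_iff₀' hΔ).2 (hb₁ x)) ((div_le_iff₀' hΔ).2 (hb₂ x))
  · calc ‖x‖ = ‖(D x e₂ / Δ) • e₁ + (D e₁ x / Δ) • e₂‖ := by rw [hrep]
      _ ≤ |D x e₂ / Δ| * ‖e₁‖ + |D e₁ x / Δ| * ‖e₂‖ := by
        refine (norm_add_le _ _).trans_eq ?_
        rw [norm_smul, norm_smul, Real.norm_eq_abs, Real.norm_eq_abs]
      _ ≤ |D x e₂ / Δ| * 1 + |D e₁ x / Δ| * 1 := by gcongr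
      _ ≤ ‖e x‖ + ‖e x‖ := by
        rw [mul_one, mul_one, he]
        exact add_le_add (le_max_left _ _) (le_max_right _ _)
      _ = 2 * ‖e x‖ := by ring

theorem exists_linearEquiv_prod_of_isEllInftyTwo {X : Type*} [NormedAddCommGroup X]
    [NormedSpace ℝ X] (hX : IsEllInftyTwo X) : ∃ e : X ≃ₗ[ℝ] ℝ × ℝ, ∀ x, ‖e x‖ = ‖x‖ := by
  obtain ⟨φ⟩ := hX
  refine ⟨φ.toLinearEquiv.trans (LinearEquiv.finTwoArrow ℝ ℝ), fun x => ?_⟩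
  rw [← φ.norm_map x]
  refine le_antisymm ?_ ((pi_norm_le_iff_of_nonneg (norm_nonneg _)).2 fun i => ?_)
  · exact max_le (norm_le_pi_norm (φ x) 0) (norm_le_pi_norm (φ x) 1)
  · fin_cases i
    · exact le_max_left _ _
    · exact le_max_right _ _

/-- A selection for a space whose norm is between one and `c` times the maximum norm. -/
theorem exists_selection_of_linearEquiv {M X : Type*} [m : PseudoEMetricSpace M]
    [NormedAddCommGroup X] [NormedSpace ℝ X] {lam : ℝ≥0} (hlam : 0 < lam) {F : M → ConvexBody X}
    (hF : ∀ S : Set M, S.encard ≤ 4 →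
      ∃ f : S → X, IsSelection (fun x : S => F x) f ∧ lipSeminorm f ≤ lam)
    (e : X ≃ₗ[ℝ] ℝ × ℝ) {c : ℝ≥0} (hc : 0 < c)
    (he : ∀ x, ‖e x‖ ≤ ‖x‖ ∧ ‖x‖ ≤ c * ‖e x‖) :
    ∃ f : M → X, IsSelection F f ∧ lipSeminorm f ≤ 3 * c * lam := by
  have hcont : Continuous e :=
    (e.toLinearMap.mkContinuous 1 fun x => by simpa using (he x).1).continuous
  have h4 : @HasFourPointSelections M (m.rescale lam) fun x => e '' F x := by
    intro u
    -- `u` may repeat points; its range has at most four.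
    obtain ⟨f, hf, hL⟩ := hF (Set.range u) <| by
      rw [← Set.image_univ]
      refine (Set.encard_image_le _ _).trans ?_
      simp
    refine ⟨fun i => e (f ⟨u i, i, rfl⟩), fun i => ⟨_, hf ⟨u i, i, rfl⟩, rfl⟩, fun i j => ?_⟩
    rw [edist_eq_enorm_sub, ← map_sub]
    refine le_trans ?_ (enorm_sub_le_of_lipSeminorm_le hlam hL ⟨u i, i, rfl⟩ ⟨u j, j, rfl⟩)
    exact enorm_le_iff_norm_le.2 (he _).1
  obtain ⟨f, hf, hd⟩ := @HasFourPointSelections.exists_selection M (m.rescale lam) _ h4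
    (fun x => (F x).convex.linear_image e.toLinearMap) (fun x => (F x).isCompact.image hcont)
  refine ⟨fun x => e.symm (f x), fun x => ?_, ?_⟩
  · obtain ⟨v, hv, hvx⟩ := hf x
    simp only [← hvx, LinearEquiv.symm_apply_apply]
    exact hv
  · have := lipSeminorm_le_of_enorm_sub_le (f := fun x => e.symm (f x)) (c := 3 * c * lam)
      (by positivity) fun x y => by
        have h1 : ‖e.symm (f x) - e.symm (f y)‖ₑ ≤ c * ‖f x - f y‖ₑ := by
          have := (he (e.symm (f x - f y))).2
          rw [LinearEquiv.apply_symm_apply, map_sub] at this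
          rw [enorm_eq_nnnorm, enorm_eq_nnnorm]
          exact_mod_cast this
        have h2 : ‖f x - f y‖ₑ ≤ 3 * (lam * edist x y) := by
          rw [← edist_eq_enorm_sub]
          exact hd x y
        calc _ ≤ (c : ℝ≥0∞) * (3 * (lam * edist x y)) := h1.trans (by gcongr)
          _ = _ := by push_cast; ring
    simpa using this

theorem mainTheorem6 {M X : Type*} [PseudoEMetricSpace M]
    [NormedAddCommGroup X] [NormedSpace ℝ X] [CompleteSpace X]
    (hX : Module.finrank ℝ X = 2)
    (lam : ℝ≥0) (hlam : 0 < lam)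
    (F : M → ConvexBody X)
    (hF : ∀ S : Set M, S.encard ≤ 4 →
      ∃ f : S → X, IsSelection (fun x : S => F x) f ∧ lipSeminorm f ≤ lam) :
    ∃ f : M → X, IsSelection F f ∧ lipSeminorm f ≤ 6 * lam ∧
      (IsEllInftyTwo X → lipSeminorm f ≤ 4 * lam) := by
  -- A single `f` must meet both bounds. For ℓ∞² the isometry gives `3 * lam`, below both of them.
  by_cases h : IsEllInftyTwo X
  · obtain ⟨e, he⟩ := exists_linearEquiv_prod_of_isEllInftyTwo h
    obtain ⟨f, hf, hL⟩ := exists_selection_of_linearEquiv hlam hF e (c := 1) one_pos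
      fun x => by simp [he x]
    rw [ENNReal.coe_one, mul_one] at hL
    exact ⟨f, hf, hL.trans (by gcongr; norm_num), fun _ => hL.trans (by gcongr; norm_num)⟩
  · obtain ⟨e, he⟩ := exists_linearEquiv_prod_of_finrank_eq_two hX
    obtain ⟨f, hf, hL⟩ := exists_selection_of_linearEquiv hlam hF e (c := 2) two_pos
      fun x => by simpa using he x
    refine ⟨f, hf, hL.trans_eq ?_, fun h' => absurd h' h⟩
    norm_num
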